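/- Call a tuple $(v;k_1,k_2,k_3,k_4;\lambda)$ of nonnegative integers with $v\ge 1$ and $k_i\le v$ for $i=1,\dots,4$ a propus parameter set if $\sum_{i=1}^4 k_i(k_i-1)=\lambda(v-1)$, $\lambda=\sum_{i=1}^4 k_i-v$, and $k_2=k_3$. Theorem. For an even positive integer $v$ there exists a propus parameter set $(v;x,y,y,z;\lambda)$ with $x,y,z\le v/2$ if and only if $v$ does not have the form $2^{2k+1}(8m+7)$, where $k$ and $m$ are nonnegative integers. -/

import Mathlib

/-- `(v; k₁, k₂, k₃, k₄; l)` is a Goethals–Seidel parameter set: `v` is a positive integer (the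
order of the cyclic group), the `kᵢ` are admissible sizes of four subsets of a set of `v` elements,
`l` is a nonnegative integer, the counting identity `∑ kᵢ (kᵢ - 1) = l (v - 1)` of difference
families holds, and `l = ∑ kᵢ - v`. The two identities are read in `ℤ`, so that no subtraction is
truncated. -/
structure IsGSParameterSet (v k₁ k₂ k₃ k₄ l : ℕ) : Prop where
  v_pos : 0 < v
  k₁_le : k₁ ≤ v
  k₂_le : k₂ ≤ v
  k₃_le : k₃ ≤ v
  k₄_le : k₄ ≤ v
  count : (k₁ : ℤ) * (k₁ - 1) + (k₂ : ℤ) * (k₂ - 1) + (k₃ : ℤ) * (k₃ - 1) + (k₄ : ℤ) * (k₄ - 1)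
    = (l : ℤ) * (v - 1)
  l_eq : (l : ℤ) = (k₁ : ℤ) + k₂ + k₃ + k₄ - v

/-- A propus parameter set is a Goethals–Seidel parameter set with `k₂ = k₃`. -/
structure IsPropusParameterSet (v k₁ k₂ k₃ k₄ l : ℕ) : Prop
    extends IsGSParameterSet v k₁ k₂ k₃ k₄ l where
  k₂_eq_k₃ : k₂ = k₃

open scoped NumberTheorySymbols

/-! Put `v = 2n`. Eliminating `λ` turns the counting identity into `(n-x)² + 2(n-y)² + (n-z)² = 2n`.
The outer squares have bases of equal parity, so writing these as `s ± t` shows that solutions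
correspond to `n = s² + t² + b²`, and Legendre's three-square theorem decides. For Legendre, a
positive ternary form of determinant one represents only sums of three squares
(`isSumThreeSq_of_ternary_form`). Dirichlet's theorem and quadratic reciprocity supply such a form
representing `n`, after factors of 4 are removed. -/

/-- `n` is a sum of three integer squares. -/
def IsSumThreeSq (n : ℤ) : Prop := ∃ p q r : ℤ, n = p ^ 2 + q ^ 2 + r ^ 2

/-! ### Reduction of ternary forms of determinant one. -/

lemma exists_abs_two_mul_add_mul_le (d : ℤ) {a : ℤ} (ha : 0 < a) :
    ∃ k : ℤ, -a ≤ 2 * (d + a * k) ∧ 2 * (d + a * k) ≤ a := by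
  refine ⟨-((2 * d + a) / (2 * a)), ?_⟩
  have h1 := Int.emod_add_mul_ediv (2 * d + a) (2 * a)
  have h2 := Int.emod_nonneg (2 * d + a) (by omega : 2 * a ≠ 0)
  have h3 := Int.emod_lt_of_pos (2 * d + a) (by omega : 0 < 2 * a)
  generalize (2 * d + a) / (2 * a) = q at *
  constructor <;> nlinarith

/-- The inequalities satisfied by a Gauss-reduced positive ternary form of determinant one
force its first two successive leading minors to be one. -/
lemma leading_minors_eq_one_of_reduced {a b d D E H : ℤ} (ha : 0 < a) (hD : 0 < D)
    (hDdef : D = a * b - d ^ 2) (hdet : D * H - E ^ 2 = a)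
    (hd1 : -a ≤ 2 * d) (hd2 : 2 * d ≤ a) (hE1 : -D ≤ 2 * E) (hE2 : 2 * E ≤ D)
    (hab : a ≤ b) (hDH : D ≤ H) : a = 1 ∧ D = 1 := by
  -- `D² ≤ D * H = a + E² ≤ a + D² / 4`; likewise `a² ≤ a * b = D + d² ≤ D + a² / 4`.
  have h1 : 3 * D ^ 2 ≤ 4 * a := by nlinarith
  have h2 : 3 * a ^ 2 ≤ 4 * D := by nlinarith
  have ha1 : a ≤ 1 := by
    by_contra! h
    have h3 : 9 * a ^ 4 ≤ 16 * D ^ 2 := by nlinarith [sq_nonneg a]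
    have h4 : 27 * a ^ 3 ≤ 64 := by
      have : a * (27 * a ^ 3) ≤ a * 64 := by nlinarith
      exact le_of_mul_le_mul_left this ha
    nlinarith [sq_nonneg (a - 2), mul_pos ha ha]
  have : a = 1 := by omega
  subst this
  exact ⟨rfl, by nlinarith⟩

/-- A positive definite integral ternary form of determinant one takes only values that are sums
of three squares. -/
theorem isSumThreeSq_of_ternary_form (N M : ℕ) : ∀ a b c d e f : ℤ, a.toNat = N →
    (a * b - d ^ 2).toNat = M → 0 < a → 0 < a * b - d ^ 2 →
    a * b * c + 2 * d * e * f - a * f ^ 2 - b * e ^ 2 - c * d ^ 2 = 1 → ∀ x y z : ℤ,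
    IsSumThreeSq (a * x ^ 2 + b * y ^ 2 + c * z ^ 2 + 2 * d * x * y + 2 * e * x * z
      + 2 * f * y * z) := by
  induction N using Nat.strong_induction_on generalizing M with
  | _ N ihN =>
  induction M using Nat.strong_induction_on with
  | _ M ihM =>
  have reduced : ∀ a b c d e f : ℤ, a.toNat = N → (a * b - d ^ 2).toNat = M → 0 < a →
      0 < a * b - d ^ 2 →
      a * b * c + 2 * d * e * f - a * f ^ 2 - b * e ^ 2 - c * d ^ 2 = 1 →
      -a ≤ 2 * d → 2 * d ≤ a → -(a * b - d ^ 2) ≤ 2 * (a * f - d * e) →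
      2 * (a * f - d * e) ≤ a * b - d ^ 2 → ∀ x y z : ℤ,
      IsSumThreeSq (a * x ^ 2 + b * y ^ 2 + c * z ^ 2 + 2 * d * x * y + 2 * e * x * z
        + 2 * f * y * z) := by
    intro a b c d e f hN hM ha hD hdet hd1 hd2 hE1 hE2 x y z
    have hdet' : (a * b - d ^ 2) * (a * c - e ^ 2) - (a * f - d * e) ^ 2 = a := by
      linear_combination a * hdet
    -- Swapping `x, y` lowers `a`; swapping `y, z` keeps `a` and lowers the second minor. Hence the
    -- lexicographic induction.
    rcases lt_or_ge b a with hba | hab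
    · have hb : 0 < b := by nlinarith [sq_nonneg d]
      have := ihN b.toNat (by omega) _ b a c d f e rfl rfl hb (by linarith)
        (by linear_combination hdet) y x z
      convert this using 1
      ring
    rcases lt_or_ge (a * c - e ^ 2) (a * b - d ^ 2) with hHD | hDH
    · have hH : 0 < a * c - e ^ 2 := by
        by_contra! h
        nlinarith [sq_nonneg (a * f - d * e)]
      have := ihM (a * c - e ^ 2).toNat (by omega) a c b e d f hN rfl ha hH
        (by linear_combination hdet) x z y
      convert this using 1
      ring
    obtain ⟨ha1, hD1⟩ := leading_minors_eq_one_of_reduced ha hD rfl hdet' hd1 hd2 hE1 hE2 hab hDH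
    subst ha1
    have hd : d = 0 := by omega
    subst hd
    have hb : b = 1 := by linarith
    subst hb
    have hf : f = 0 := by omega
    subst hf
    -- The determinant condition now reads `c = 1 + e²`, so completing the square finishes.
    refine ⟨x + e * z, y, z, ?_⟩
    linear_combination z ^ 2 * hdet
  intro a b c d e f hN hM ha hD hdet x y z
  obtain ⟨k, hk1, hk2⟩ := exists_abs_two_mul_add_mul_le (a * f - d * e) hD
  obtain ⟨j, hj1, hj2⟩ := exists_abs_two_mul_add_mul_le d ha
  -- substitute `x = X + j Y`, `y = Y + k z`
  have hminor : a * (a * j ^ 2 + 2 * d * j + b) - (d + a * j) ^ 2 = a * b - d ^ 2 := by ring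
  have := reduced a (a * j ^ 2 + 2 * d * j + b) (c + 2 * f * k + b * k ^ 2) (d + a * j)
    (e + d * k) (f + b * k + j * (e + d * k)) hN (by rw [hminor, hM]) ha (by rwa [hminor])
    (by linear_combination hdet) hj1 hj2 (by rw [hminor]; linarith) (by rw [hminor]; linarith)
    (x - j * (y - k * z)) (y - k * z) z
  convert this using 1
  ring

/-- With `a = (t² + b) / (b n - 1)`, the symmetric matrix with rows `(a, t, 1)`, `(t, b n - 1, 0)`,
`(1, 0, n)` has determinant one, and its form takes the value `n` at `(0, 0, 1)`. -/
lemma isSumThreeSq_of_dvd {n b t : ℤ} (hb : 0 < b) (hM : 0 < b * n - 1)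
    (h : b * n - 1 ∣ t ^ 2 + b) : IsSumThreeSq n := by
  obtain ⟨a, ha⟩ := h
  have ha0 : 0 < a := by
    by_contra! h
    nlinarith [sq_nonneg t]
  have hD : a * (b * n - 1) - t ^ 2 = b := by linarith
  have := isSumThreeSq_of_ternary_form _ _ a (b * n - 1) n t 1 0 rfl rfl ha0 (by linarith)
    (by linear_combination n * hD) 0 0 1
  simpa using this

/-! ### Representing `n` via primes in progressions and reciprocity. -/

lemma exists_dvd_sq_sub_of_jacobiSym_eq_one {p : ℕ} (hp : p.Prime) {a : ℤ} (h : J(a | p) = 1) :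
    ∃ t : ℤ, (p : ℤ) ∣ t ^ 2 - a := by
  have := Fact.mk hp
  obtain ⟨r, hr⟩ := ZMod.isSquare_of_jacobiSym_eq_one h
  obtain ⟨t, rfl⟩ := ZMod.intCast_surjective r
  refine ⟨t, ?_⟩
  rw [← ZMod.intCast_zmod_eq_zero_iff_dvd]
  push_cast
  rw [hr]
  ring

/-- Dirichlet gives a prime `p = b n - 1` with `p ≡ b ≡ 1 mod 4`. Then `(-b/p) = (b/p) = (p/b) =
(-1/b) = 1`. -/
lemma isSumThreeSq_of_mod_four_eq_two {n : ℕ} (hn : n % 4 = 2) : IsSumThreeSq n := by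
  have hcop : Nat.Coprime (n - 1) (4 * n) := by
    refine Nat.Coprime.mul_right ?_ ?_
    · rw [show 4 = 2 ^ 2 by rfl]
      exact Nat.Coprime.pow_right _ (Nat.coprime_two_right.2 (Nat.odd_iff.2 (by omega)))
    · have := (Nat.coprime_self_add_right (m := n - 1) (n := 1)).2 (by simp)
      rwa [Nat.sub_add_cancel (by omega)] at this
  obtain ⟨p, hpn, hp, hmod⟩ := Nat.forall_exists_prime_gt_and_modEq n (by omega) hcop
  obtain ⟨j, hj⟩ := (Nat.modEq_iff_dvd' (by omega)).1 hmod.symm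
  have hpb : p + 1 = (4 * j + 1) * n := by
    zify [show n - 1 ≤ p by omega, show 1 ≤ n by omega] at hj ⊢
    linear_combination hj
  have hp4 : p % 4 = 1 := by
    have : p + 1 = 4 * (j * n) + n := by rw [hpb]; ring
    omega
  have hbodd : Odd (4 * j + 1) := Nat.odd_iff.2 (by omega)
  have hJ : J(-((4 * j + 1 : ℕ) : ℤ) | p) = 1 := by
    rw [jacobiSym.neg _ (Nat.odd_iff.2 (by omega)), ZMod.χ₄_nat_one_mod_four hp4, one_mul,
      jacobiSym.quadratic_reciprocity_one_mod_four' hbodd hp4,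
      jacobiSym.mod_left' (a₂ := -1) (b := 4 * j + 1), jacobiSym.at_neg_one hbodd,
      ZMod.χ₄_nat_one_mod_four (by omega)]
    refine Int.ModEq.symm ((Int.modEq_iff_dvd).2 ⟨n, ?_⟩)
    zify at hpb
    push_cast
    linear_combination hpb
  obtain ⟨t, ht⟩ := exists_dvd_sq_sub_of_jacobiSym_eq_one hp hJ
  zify at hpb
  have hpb' : ((4 * j + 1 : ℕ) : ℤ) * n - 1 = p := by push_cast; linear_combination -hpb
  refine isSumThreeSq_of_dvd (b := (4 * j + 1 : ℕ)) (t := t) (by positivity) ?_ ?_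
  · rw [hpb']; exact_mod_cast hp.pos
  · rwa [hpb', ← sub_neg_eq_add]

/-- The sufficient condition for odd `n`, with `b = 8 j + c` and `2 p = b n - 1`. -/
lemma isSumThreeSq_of_odd_aux {n c r : ℕ} (hr : 2 * r + 1 = c * n) (hn : Odd n)
    (hc : c = 1 ∧ r % 4 = 1 ∨ c = 3 ∧ r % 2 = 1) : IsSumThreeSq n := by
  have hrodd : Odd r := Nat.odd_iff.2 (by omega)
  have hcop : Nat.Coprime r (4 * n) := by
    refine Nat.Coprime.mul_right ?_ ?_
    · rw [show 4 = 2 ^ 2 by rfl]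
      exact Nat.Coprime.pow_right _ (Nat.coprime_two_right.2 hrodd)
    · have h : Nat.Coprime r (2 * r + 1) := by simp
      rw [hr] at h
      exact h.coprime_mul_left_right
  have hn0 := hn.pos
  obtain ⟨p, hpr, hp, hmod⟩ := Nat.forall_exists_prime_gt_and_modEq r (by omega) hcop
  obtain ⟨j, hj⟩ := (Nat.modEq_iff_dvd' hpr.le).1 hmod.symm
  have hpj : p = 4 * (n * j) + r := by
    rw [← mul_assoc]; omega
  have hpb : 2 * p + 1 = (8 * j + c) * n := by
    rw [add_mul, ← hr, hpj]; ring
  have hp2 : p % 4 = r % 4 := by omega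
  have hbodd : Odd (8 * j + c) := Nat.odd_iff.2 (by omega)
  have hneg : J(-2 | 8 * j + c) = 1 := by
    rw [jacobiSym.at_neg_two hbodd, ZMod.χ₈'_nat_eq_if_mod_eight]
    rw [if_neg (by omega), if_pos (by omega)]
  -- `-2p ≡ 1` modulo `b`, and `(-2/b) = 1` because `b ≡ 1` or `3 mod 8`.
  have hpJ : J(p | 8 * j + c) = 1 := by
    have h1 : J(-2 * p | 8 * j + c) = 1 := by
      rw [jacobiSym.mod_left' (a₂ := 1), jacobiSym.one_left]
      refine Int.ModEq.symm ((Int.modEq_iff_dvd).2 ⟨-n, ?_⟩)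
      zify at hpb
      push_cast
      linear_combination -hpb
    rwa [jacobiSym.mul_left, hneg, one_mul] at h1
  have hpodd : Odd p := Nat.odd_iff.2 (by omega)
  have hJ : J(-((8 * j + c : ℕ) : ℤ) | p) = 1 := by
    rw [jacobiSym.neg _ hpodd]
    have hr4 : r % 4 = 1 ∨ r % 4 = 3 := by omega
    rcases hr4 with h | h
    · rw [ZMod.χ₄_nat_one_mod_four (by omega), one_mul,
        jacobiSym.quadratic_reciprocity_one_mod_four' hbodd (by omega), hpJ]
    -- Here `c = 3`, so `p ≡ b ≡ 3 mod 4` and the sign from reciprocity cancels that of `(-1/p)`.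
    · rw [ZMod.χ₄_nat_three_mod_four (by omega),
        jacobiSym.quadratic_reciprocity_three_mod_four (by omega) (by omega), hpJ]
      rfl
  obtain ⟨t, ht⟩ := exists_dvd_sq_sub_of_jacobiSym_eq_one hp hJ
  rw [sub_neg_eq_add] at ht
  -- An odd root makes `s² + b` even, which lifts divisibility by `p` to `2p = b n - 1`.
  obtain ⟨s, hs, hs2⟩ : ∃ s : ℤ, (p : ℤ) ∣ s ^ 2 + (8 * j + c : ℕ) ∧ s % 2 = 1 := by
    rcases Int.emod_two_eq_zero_or_one t with h | h
    · refine ⟨t + p, ?_, by have := Nat.odd_iff.1 hpodd; omega⟩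
      have : (t + p) ^ 2 + ((8 * j + c : ℕ) : ℤ) = (t ^ 2 + (8 * j + c : ℕ)) + p * (2 * t + p) := by
        ring
      rw [this]
      exact dvd_add ht (dvd_mul_right _ _)
    · exact ⟨t, ht, h⟩
  have h2 : (2 : ℤ) ∣ s ^ 2 + (8 * j + c : ℕ) := by
    have h3 : Odd (s ^ 2) := (Int.odd_iff.2 hs2).pow
    exact (h3.add_odd ((Int.odd_coe_nat _).2 hbodd)).two_dvd
  have hcop2 : IsCoprime (2 : ℤ) p := by
    exact_mod_cast Nat.isCoprime_iff_coprime.2 (Nat.coprime_two_left.2 hpodd)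
  zify at hpb
  have hpb' : ((8 * j + c : ℕ) : ℤ) * n - 1 = 2 * p := by push_cast; linear_combination -hpb
  refine isSumThreeSq_of_dvd (b := (8 * j + c : ℕ)) (t := s) ?_ ?_ ?_
  · exact_mod_cast hbodd.pos
  · rw [hpb']
    have := hp.pos
    positivity
  · rw [hpb']
    exact hcop2.mul_dvd h2 hs

/-! ### Descent by four and Legendre's theorem. -/

lemma IsSumThreeSq.four_mul {n : ℤ} (h : IsSumThreeSq n) : IsSumThreeSq (4 * n) := by
  obtain ⟨p, q, r, rfl⟩ := h
  exact ⟨2 * p, 2 * q, 2 * r, by ring⟩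

lemma sq_emod_eight (x : ℤ) :
    x % 2 = 0 ∧ (x ^ 2 % 8 = 0 ∨ x ^ 2 % 8 = 4) ∨ x % 2 = 1 ∧ x ^ 2 % 8 = 1 := by
  have h : x % 8 = 0 ∨ x % 8 = 1 ∨ x % 8 = 2 ∨ x % 8 = 3 ∨ x % 8 = 4 ∨ x % 8 = 5 ∨ x % 8 = 6 ∨
    x % 8 = 7 := by omega
  rcases h with h | h | h | h | h | h | h | h <;> simp [pow_two, Int.mul_emod, h] <;> omega

lemma isSumThreeSq_four_mul_iff {n : ℤ} : IsSumThreeSq (4 * n) ↔ IsSumThreeSq n := by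
  refine ⟨?_, IsSumThreeSq.four_mul⟩
  rintro ⟨p, q, r, h⟩
  have hp := sq_emod_eight p
  have hq := sq_emod_eight q
  have hr := sq_emod_eight r
  refine ⟨p / 2, q / 2, r / 2, ?_⟩
  -- Modulo 4 squares are 0 or 1, so a sum of three divisible by 4 has only even bases.
  have hp2 : p = 2 * (p / 2) := by omega
  have hq2 : q = 2 * (q / 2) := by omega
  have hr2 : r = 2 * (r / 2) := by omega
  generalize p / 2 = p' at *
  generalize q / 2 = q' at *
  generalize r / 2 = r' at *
  subst hp2 hq2 hr2
  linarith

lemma not_isSumThreeSq_of_emod_eight {n : ℤ} (hn : n % 8 = 7) : ¬ IsSumThreeSq n := by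
  rintro ⟨p, q, r, h⟩
  have hp := sq_emod_eight p
  have hq := sq_emod_eight q
  have hr := sq_emod_eight r
  omega

/-- **Legendre's three-square theorem**. -/
theorem isSumThreeSq_natCast_iff (n : ℕ) :
    IsSumThreeSq n ↔ ¬ ∃ k m : ℕ, n = 4 ^ k * (8 * m + 7) := by
  constructor
  · rintro h ⟨k, m, rfl⟩
    induction k with
    | zero => exact not_isSumThreeSq_of_emod_eight (by push_cast; omega) h
    | succ k ih =>
      refine ih (isSumThreeSq_four_mul_iff.1 ?_)
      convert h using 1
      push_cast
      ring
  · induction n using Nat.strong_induction_on with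
    | _ n ih =>
    intro h
    rcases Nat.eq_zero_or_pos n with rfl | hpos
    · exact ⟨0, 0, 0, by simp⟩
    have h7 : n % 8 ≠ 7 := fun h7 => h ⟨0, n / 8, by omega⟩
    have hcases : n % 4 = 0 ∨ n % 4 = 2 ∨ n % 8 = 3 ∨ n % 4 = 1 := by omega
    rcases hcases with h0 | h2 | h3 | h1
    · obtain ⟨m, rfl⟩ : ∃ m, n = 4 * m := ⟨n / 4, by omega⟩
      have := ih m (by omega) (fun ⟨k, l, hk⟩ => h ⟨k + 1, l, by rw [hk]; ring⟩)
      simpa using this.four_mul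
    · exact isSumThreeSq_of_mod_four_eq_two h2
    · exact isSumThreeSq_of_odd_aux (c := 1) (r := (n - 1) / 2) (by omega)
        (Nat.odd_iff.2 (by omega)) (Or.inl ⟨rfl, by omega⟩)
    · exact isSumThreeSq_of_odd_aux (c := 3) (r := (3 * n - 1) / 2) (by omega)
        (Nat.odd_iff.2 (by omega)) (Or.inr ⟨rfl, by omega⟩)

/-! ### From propus parameters to three squares. -/

lemma abs_le_sq (x : ℤ) : |x| ≤ x ^ 2 := by
  rw [← sq_abs]
  have := abs_nonneg x
  nlinarith [Int.le_self_sq |x|]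

lemma exists_natCast_eq_sub_abs {n : ℕ} {x : ℤ} (h : x ^ 2 ≤ 2 * n) :
    ∃ k : ℕ, (k : ℤ) = n - |x| := by
  have : |x| ≤ n := by
    by_contra! h'
    rw [← sq_abs] at h
    nlinarith
  exact ⟨(n - |x|).toNat, by omega⟩

lemma exists_isPropusParameterSet_iff_isSumThreeSq {n : ℕ} (hn : 0 < n) :
    (∃ x y z l : ℕ, IsPropusParameterSet (2 * n) x y y z l ∧
      2 * x ≤ 2 * n ∧ 2 * y ≤ 2 * n ∧ 2 * z ≤ 2 * n) ↔ IsSumThreeSq n := by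
  constructor
  · rintro ⟨x, y, z, l, h, -, -, -⟩
    have hcount := h.count
    rw [h.l_eq] at hcount
    push_cast at hcount
    have key : ((n : ℤ) - x) ^ 2 + 2 * (n - y) ^ 2 + (n - z) ^ 2 = 2 * n := by
      linear_combination hcount
    have hx := sq_emod_eight (n - x)
    have hz := sq_emod_eight (n - z)
    obtain ⟨s, hs⟩ : ∃ s : ℤ, (n : ℤ) - x = (n - z) + 2 * s :=
      ⟨((n : ℤ) - x - (n - z)) / 2, by omega⟩
    refine ⟨s, n - z + s, n - y, ?_⟩
    rw [hs] at key
    linarith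
  · rintro ⟨s, t, b, h⟩
    obtain ⟨x, hx⟩ := exists_natCast_eq_sub_abs (n := n) (x := s + t)
      (by nlinarith [sq_nonneg (s - t), sq_nonneg b])
    obtain ⟨y, hy⟩ := exists_natCast_eq_sub_abs (n := n) (x := b)
      (by nlinarith [sq_nonneg s, sq_nonneg t])
    obtain ⟨z, hz⟩ := exists_natCast_eq_sub_abs (n := n) (x := s - t)
      (by nlinarith [sq_nonneg (s + t), sq_nonneg b])
    have hx0 := abs_nonneg (s + t)
    have hy0 := abs_nonneg b
    have hz0 := abs_nonneg (s - t)
    have hx1 := abs_le_sq (s + t)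
    have hy1 := abs_le_sq b
    have hz1 := abs_le_sq (s - t)
    -- `|u| ≤ u²` bounds the total deficit `|s + t| + 2|b| + |s - t|` by `2n`, while the four sizes
    -- sum to `4n` minus it.
    have hl : (0 : ℤ) ≤ x + y + y + z - (2 * n : ℕ) := by
      push_cast
      nlinarith
    have hl' := Int.toNat_of_nonneg hl
    refine ⟨x, y, z, ((x : ℤ) + y + y + z - (2 * n : ℕ)).toNat,
      ⟨⟨by omega, by omega, by omega, by omega, by omega, ?_, hl'⟩, rfl⟩,
      by omega, by omega, by omega⟩
    rw [hl']
    push_cast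
    rw [hx, hy, hz]
    linear_combination sq_abs (s + t) + 2 * sq_abs b + sq_abs (s - t) - 2 * h

theorem theorem2 (v : ℕ) (hv : 0 < v) (hev : Even v) :
    (∃ x y z l : ℕ, IsPropusParameterSet v x y y z l ∧ 2 * x ≤ v ∧ 2 * y ≤ v ∧ 2 * z ≤ v) ↔
      ¬ ∃ k m : ℕ, v = 2 ^ (2 * k + 1) * (8 * m + 7) := by
  obtain ⟨n, rfl⟩ := hev.two_dvd
  rw [exists_isPropusParameterSet_iff_isSumThreeSq (by omega), isSumThreeSq_natCast_iff]
  have h (k m : ℕ) : 2 ^ (2 * k + 1) * (8 * m + 7) = 2 * (4 ^ k * (8 * m + 7)) := by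
    rw [pow_succ, pow_mul]
    ring
  simp [h]
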